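/- Let $K$ be a field and let $q\in K$ be nonzero and not a root of unity (for instance, $q$ an indeterminate and $K=\mathbb{Q}(q)$). Write $(q;q)_n=\prod_{j=1}^{n}(1-q^j)$ and $\binom{n}{k}_q=\frac{(q;q)_n}{(q;q)_k\,(q;q)_{n-k}}$ for $0\le k\le n$. For integers $i\ge 0$ and $N\ge 0$ put $$s_{i,N}=q^{N(N+1)}\sum_{n=-N}^{N}\binom{i+N-n}{i}_q\binom{i+N+n}{i}_q\,q^{-n^2}(-1)^n,$$ and put $s_{-1,0}=1$ and $s_{-1,N}=0$ for $N\ge 1$; also set $s_{i,-1}=0$ for all $i\ge 0$. Let $s_i=\sum_{N\ge 0}s_{i,N}v^N\in K[[v]]$ for $i\ge -1$; in particular $s_{-1}=1$. Then for every integer $i\ge 0$ the series $s_{i-1}$ is invertible in $K[[v]]$ and $$\cfrac{1}{1+v-\cfrac{(1-q^{i+1})^2v}{1+v-\cfrac{(1-q^{i+2})^2v}{1+v-\cdots}}}=\frac{s_i}{s_{i-1}},$$ where the infinite continued fraction is understood as the limit in $K[[v]]$ of its finite truncations, that is, each coefficient of the truncations is eventually equal to the corresponding coefficient of $s_i/s_{i-1}$.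 Moreover, for all integers $i\ge 0$ and $N\ge 0$, $$s_{i,N}+s_{i,N-1}-(1-q^{i+1})^2s_{i+1,N-1}-s_{i-1,N}=0.$$ -/

import Mathlib

open Filter PowerSeries

noncomputable section

/-- The `q`-shifted factorial `(x; q)_n = (1 - x)(1 - x q) ⋯ (1 - x q ^ (n - 1))`. -/
def qShifted {K : Type*} [Field K] (x q : K) (n : ℕ) : K :=
  ∏ j ∈ Finset.range n, (1 - x * q ^ j)

/-- The Gaussian binomial coefficient `(q; q)_n / ((q; q)_k (q; q)_(n - k))` for `k ≤ n`, with the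
usual value `0` for `k > n`. -/
def gaussBinom {K : Type*} [Field K] (q : K) (n k : ℕ) : K :=
  if k ≤ n then qShifted q q n / (qShifted q q k * qShifted q q (n - k)) else 0

/-- The coefficient `s_{i,N}` for `i ≥ 0`. In the range of summation `N - n` and `N + n` are
nonnegative, so `toNat` does not truncate. -/
def sCoeffNat {K : Type*} [Field K] (q : K) (i N : ℕ) : K :=
  q ^ (N * (N + 1)) *
    ∑ n ∈ Finset.Icc (-(N : ℤ)) (N : ℤ),
      gaussBinom q (i + ((N : ℤ) - n).toNat) i * gaussBinom q (i + ((N : ℤ) + n).toNat) i *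
        q ^ (-(n ^ 2)) * (-1) ^ n

/-- The coefficient `s_{i,N}` for an integer index `i ≥ -1`; the series `s_{-1}` is the constant
`1`. (Indices `i < -1` are not used.) -/
def sCoeff {K : Type*} [Field K] (q : K) : ℤ → ℕ → K
  | Int.ofNat i, N => sCoeffNat q i N
  | Int.negSucc _, N => if N = 0 then 1 else 0

/-- The formal power series `s_i = ∑_N s_{i,N} v ^ N` in the variable `v`. -/
def sSeries {K : Type*} [Field K] (q : K) (i : ℤ) : K⟦X⟧ :=
  PowerSeries.mk (sCoeff q i)

/-- The `m`-th truncation of the continued fraction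
`1 / (1 + v - a 0 v / (1 + v - a 1 v / (1 + v - ⋯)))`, as a power series in `v`: the `m`-th
occurrence of `1 / (1 + v - ⋯)` is the last one that is kept, and what follows is replaced by `0`.
Every denominator has constant coefficient `1`, hence is invertible. -/
def cfTrunc {K : Type*} [Field K] : (ℕ → K) → ℕ → K⟦X⟧
  | _, 0 => 0
  | a, m + 1 => (1 + X - C (a 0) * X * cfTrunc (fun j => a (j + 1)) m)⁻¹

/-- The infinite continued fraction `1 / (1 + v - a 0 v / (1 + v - a 1 v / ⋯))` converges to `F`
as a formal power series in `v`: each coefficient of the truncations is eventually equal to the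
corresponding coefficient of `F`. -/
def CFConvergesTo {K : Type*} [Field K] (a : ℕ → K) (F : K⟦X⟧) : Prop :=
  ∀ N : ℕ, ∀ᶠ m in atTop, coeff N (cfTrunc a m) = coeff N F

end

/-! With a = N - n and b = N + n one has ab = N² - n², so s_{i,N} is (-1)^N q^N times the
alternating convolution A_{2N}(f) of f(a) = binom(i+a, i)_q with itself. Put c = q^i. Lowering i
replaces f(a) by f(a) - c f(a-1) (q-Pascal); raising i multiplies f(a) by 1 - c q^(a+1), up to the
factor 1 - q^(i+1). The three-term recurrence thus becomes an identity between convolutions of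
degrees n + 2 and n (`altConv_recurrence`), which needs only the first-order recursion of f.
Dividing the resulting relation of series by s_{i-1} shows that the quotients F_i = s_i / s_{i-1}
satisfy F_i (1 + v - (1 - q^(i+1))² v F_{i+1}) = 1, and each level of the fraction gains one power
of v (`cfTrunc_congr_of_tails`). -/

open Finset in
/-- The alternating convolution `∑_{a + b = n} (-1) ^ a q ^ (a b) f a f b`. -/
def altConv {K : Type*} [Field K] (q : K) (f : ℕ → K) (n : ℕ) : K :=
  ∑ p ∈ antidiagonal n, (-1) ^ p.1 * q ^ (p.1 * p.2) * f p.1 * f p.2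

/-- The sequence `f` shifted to the right by one place. -/
def shiftRight {K : Type*} [Field K] (f : ℕ → K) : ℕ → K
  | 0 => 0
  | a + 1 => f a

/-! ### Alternating convolutions -/

section Antidiagonal

open Finset

variable {K : Type*} [Field K]

/-- Swapping a and b cancels terms in pairs, without fixed points since n is odd; hence
characteristic 2 is no exception. -/
theorem sum_antidiagonal_odd_eq_zero {n : ℕ} (hn : Odd n) (g : ℕ → ℕ → K)
    (hg : ∀ a b, a + b = n → g b a = -g a b) :
    ∑ p ∈ antidiagonal n, g p.1 p.2 = 0 := by
  refine Finset.sum_involution (fun p _ => p.swap) ?_ ?_ ?_ ?_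
  · rintro ⟨a, b⟩ h
    simp only [Prod.fst_swap, Prod.snd_swap]
    rw [hg a b (mem_antidiagonal.1 h), add_neg_cancel]
  · rintro ⟨a, b⟩ h _ he
    have h1 : a + b = n := mem_antidiagonal.1 h
    have h2 : b = a := congrArg Prod.fst he
    obtain ⟨k, hk⟩ := hn
    omega
  · rintro ⟨a, b⟩ h
    have h1 : a + b = n := mem_antidiagonal.1 h
    exact mem_antidiagonal.2 (by simp; omega)
  · rintro ⟨a, b⟩ _
    rfl

theorem sum_antidiagonal_shiftRight_fst (f : ℕ → K) (g : ℕ → ℕ → K) (n : ℕ) :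
    ∑ p ∈ antidiagonal (n + 1), g p.1 p.2 * shiftRight f p.1 =
      ∑ p ∈ antidiagonal n, g (p.1 + 1) p.2 * f p.1 := by
  rw [Finset.Nat.sum_antidiagonal_succ]
  simp [shiftRight]

theorem sum_antidiagonal_shiftRight_snd (f : ℕ → K) (g : ℕ → ℕ → K) (n : ℕ) :
    ∑ p ∈ antidiagonal (n + 1), g p.1 p.2 * shiftRight f p.2 =
      ∑ p ∈ antidiagonal n, g p.1 (p.2 + 1) * f p.2 := by
  rw [Finset.Nat.sum_antidiagonal_succ']
  simp [shiftRight]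

theorem sum_antidiagonal_comm (g : ℕ → ℕ → K) (n : ℕ) :
    ∑ p ∈ antidiagonal n, g p.1 p.2 = ∑ p ∈ antidiagonal n, g p.2 p.1 :=
  (Finset.Nat.sum_antidiagonal_swap (f := fun p : ℕ × ℕ => g p.2 p.1)).symm ▸ rfl

theorem neg_one_pow_eq_of_even_add {a b : ℕ} (h : Even (a + b)) : (-1 : K) ^ a = (-1) ^ b := by
  rcases Nat.even_or_odd a with ha | ha
  · rw [ha.neg_one_pow, ((Nat.even_add.1 h).1 ha).neg_one_pow]
  · have hb : Odd b := by
      rw [← Nat.not_even_iff_odd] at ha ⊢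
      exact fun hb => ha ((Nat.even_add.1 h).2 hb)
    rw [ha.neg_one_pow, hb.neg_one_pow]

theorem neg_one_pow_eq_neg_of_odd_add {a b : ℕ} (h : Odd (a + b)) :
    (-1 : K) ^ b = -(-1) ^ a := by
  have h1 : Even (b + (a + 1)) := by
    obtain ⟨k, hk⟩ := h
    exact ⟨k + 1, by omega⟩
  rw [neg_one_pow_eq_of_even_add h1, pow_succ]
  ring

variable (q c : K) (f : ℕ → K)

theorem sum_antidiagonal_twist_swap {n : ℕ} (hn : Even n) :
    ∑ p ∈ antidiagonal n, (-1) ^ p.1 * q ^ (p.1 * p.2) * q ^ p.2 * f p.1 * f p.2 =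
      ∑ p ∈ antidiagonal n, (-1) ^ p.1 * q ^ (p.1 * p.2) * q ^ p.1 * f p.1 * f p.2 := by
  rw [sum_antidiagonal_comm
    (fun a b => (-1) ^ a * q ^ (a * b) * q ^ b * f a * f b)]
  refine Finset.sum_congr rfl fun p hp => ?_
  rw [← mem_antidiagonal.1 hp] at hn
  rw [neg_one_pow_eq_of_even_add hn, mul_comm p.2 p.1]
  ring

variable {q c f}

/-- The contiguous relation between the twisted sums of total degrees `n + 1` and `n`. -/
theorem sum_antidiagonal_twist_succ
    (hf : ∀ a, f (a + 1) * (1 - q ^ (a + 1)) = f a * (1 - c * q ^ (a + 1)))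
    {n : ℕ} (hn : Even n) :
    ∑ p ∈ antidiagonal (n + 1), (-1) ^ p.1 * q ^ (p.1 * p.2) * q ^ p.1 * f p.1 * f p.2 =
      ∑ p ∈ antidiagonal n, (-1) ^ p.1 * q ^ (p.1 * p.2) * q ^ p.1 * f p.1 * f p.2 -
        c * q ^ (n + 1) * altConv q f n := by
  -- Lowering the index keeps a = 0 valid: both sides are then zero.
  have hf' : ∀ a, f a * (1 - q ^ a) = shiftRight f a * (1 - c * q ^ a) := by
    rintro (_ | a)
    · simp [shiftRight]
    · exact hf a
  have hodd : Odd (n + 1) := hn.add_one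
  have h0 := sum_antidiagonal_odd_eq_zero hodd
    (fun a b => (-1) ^ a * q ^ (a * b) * f a * f b) (by
      intro a b hab
      rw [← hab] at hodd
      rw [neg_one_pow_eq_neg_of_odd_add hodd, mul_comm b a]
      ring)
  have h1 := sum_antidiagonal_shiftRight_fst f
    (fun a b => (-1) ^ a * q ^ (a * b) * (1 - c * q ^ a) * f b) n
  have h2 : ∑ p ∈ antidiagonal (n + 1),
      ((-1) ^ p.1 * q ^ (p.1 * p.2) * (1 - c * q ^ p.1) * f p.2) * shiftRight f p.1 =
      ∑ p ∈ antidiagonal (n + 1), (-1) ^ p.1 * q ^ (p.1 * p.2) * f p.1 * f p.2 -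
      ∑ p ∈ antidiagonal (n + 1), (-1) ^ p.1 * q ^ (p.1 * p.2) * q ^ p.1 * f p.1 * f p.2 := by
    rw [← Finset.sum_sub_distrib]
    refine Finset.sum_congr rfl fun p _ => ?_
    linear_combination (-(-1) ^ p.1 * q ^ (p.1 * p.2) * f p.2) * hf' p.1
  have h3 : ∑ p ∈ antidiagonal n,
      ((-1) ^ (p.1 + 1) * q ^ ((p.1 + 1) * p.2) * (1 - c * q ^ (p.1 + 1)) * f p.2) * f p.1 =
      c * q ^ (n + 1) * altConv q f n -
      ∑ p ∈ antidiagonal n, (-1) ^ p.1 * q ^ (p.1 * p.2) * q ^ p.2 * f p.1 * f p.2 := by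
    rw [altConv, Finset.mul_sum, ← Finset.sum_sub_distrib]
    refine Finset.sum_congr rfl fun p hp => ?_
    rw [← mem_antidiagonal.1 hp]
    ring
  rw [sum_antidiagonal_twist_swap q f hn] at h3
  linear_combination h0 + h2 - h1 - h3

/-- The effect on `altConv` of passing from `f a` to `f a - c f (a - 1)`. -/
theorem altConv_sub_shiftRight {n : ℕ} (hn : Even n) :
    altConv q f (n + 2) - altConv q (fun a => f a - c * shiftRight f a) (n + 2) =
      2 * c * ∑ p ∈ antidiagonal (n + 1),
          (-1) ^ p.1 * q ^ (p.1 * p.2) * q ^ p.1 * f p.1 * f p.2 +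
        c ^ 2 * q ^ (n + 1) * altConv q f n := by
  have hodd : Odd (n + 1) := hn.add_one
  have h1 := sum_antidiagonal_shiftRight_fst f
    (fun a b => (-1) ^ a * q ^ (a * b) * f b) (n + 1)
  have h2 := sum_antidiagonal_shiftRight_snd f
    (fun a b => (-1) ^ a * q ^ (a * b) * f a) (n + 1)
  have h3 := sum_antidiagonal_shiftRight_fst f
    (fun a b => (-1) ^ a * q ^ (a * b) * shiftRight f b) (n + 1)
  have h4 := sum_antidiagonal_shiftRight_snd f
    (fun a b => (-1) ^ (a + 1) * q ^ ((a + 1) * b) * f a) n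
  have h5 := sum_antidiagonal_comm
    (fun a b => (-1) ^ (a + 1) * q ^ ((a + 1) * b) * f b * f a) (n + 1)
  have h6 : ∑ p ∈ antidiagonal (n + 1),
      (-1) ^ (p.2 + 1) * q ^ ((p.2 + 1) * p.1) * f p.1 * f p.2 =
      ∑ p ∈ antidiagonal (n + 1), (-1) ^ p.1 * q ^ (p.1 * p.2) * q ^ p.1 * f p.1 * f p.2 := by
    refine Finset.sum_congr rfl fun p hp => ?_
    rw [← mem_antidiagonal.1 hp] at hodd
    rw [pow_succ, neg_one_pow_eq_neg_of_odd_add hodd]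
    ring
  have h7 : ∑ p ∈ antidiagonal (n + 1),
      (-1) ^ p.1 * q ^ (p.1 * (p.2 + 1)) * f p.1 * f p.2 =
      ∑ p ∈ antidiagonal (n + 1), (-1) ^ p.1 * q ^ (p.1 * p.2) * q ^ p.1 * f p.1 * f p.2 :=
    Finset.sum_congr rfl fun p _ => by ring
  have h8 : ∑ p ∈ antidiagonal (n + 1),
      (-1) ^ (p.1 + 1) * q ^ ((p.1 + 1) * p.2) * shiftRight f p.2 * f p.1 =
      ∑ p ∈ antidiagonal (n + 1),
      (-1) ^ (p.1 + 1) * q ^ ((p.1 + 1) * p.2) * f p.1 * shiftRight f p.2 :=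
    Finset.sum_congr rfl fun p _ => by ring
  have h9 : ∑ p ∈ antidiagonal n,
      (-1) ^ (p.1 + 1) * q ^ ((p.1 + 1) * (p.2 + 1)) * f p.1 * f p.2 =
      -(q ^ (n + 1) * altConv q f n) := by
    rw [altConv, Finset.mul_sum, ← Finset.sum_neg_distrib]
    refine Finset.sum_congr rfl fun p hp => ?_
    rw [← mem_antidiagonal.1 hp]
    ring
  -- Bilinear expansion: the two cross terms drop to degree n + 1, where they agree, and the doubly
  -- shifted term drops to degree n.
  have h10 : altConv q f (n + 2) - altConv q (fun a => f a - c * shiftRight f a) (n + 2) =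
      c * ∑ p ∈ antidiagonal (n + 1 + 1),
          (-1) ^ p.1 * q ^ (p.1 * p.2) * f p.2 * shiftRight f p.1 +
      c * ∑ p ∈ antidiagonal (n + 1 + 1),
          (-1) ^ p.1 * q ^ (p.1 * p.2) * f p.1 * shiftRight f p.2 -
      c ^ 2 * ∑ p ∈ antidiagonal (n + 1 + 1),
          (-1) ^ p.1 * q ^ (p.1 * p.2) * shiftRight f p.2 * shiftRight f p.1 := by
    simp only [altConv, Finset.mul_sum, ← Finset.sum_sub_distrib, ← Finset.sum_add_distrib]
    exact Finset.sum_congr rfl fun p _ => by ring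
  rw [h10, h1, h2, h3, h5, h6, h7, h8, h4, h9]
  ring

theorem altConv_mul_one_sub {n : ℕ} (hn : Even n) :
    altConv q (fun a => f a * (1 - c * q ^ (a + 1))) n =
      (1 + c ^ 2 * q ^ (n + 2)) * altConv q f n -
        2 * c * q * ∑ p ∈ antidiagonal n,
          (-1) ^ p.1 * q ^ (p.1 * p.2) * q ^ p.1 * f p.1 * f p.2 := by
  have h := sum_antidiagonal_twist_swap q f hn
  have h1 : altConv q (fun a => f a * (1 - c * q ^ (a + 1))) n =
      (1 + c ^ 2 * q ^ (n + 2)) * altConv q f n -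
      c * q * ∑ p ∈ antidiagonal n,
          (-1) ^ p.1 * q ^ (p.1 * p.2) * q ^ p.1 * f p.1 * f p.2 -
      c * q * ∑ p ∈ antidiagonal n,
          (-1) ^ p.1 * q ^ (p.1 * p.2) * q ^ p.2 * f p.1 * f p.2 := by
    simp only [altConv, Finset.mul_sum, ← Finset.sum_sub_distrib]
    refine Finset.sum_congr rfl fun p hp => ?_
    rw [← mem_antidiagonal.1 hp]
    ring
  rw [h1, h]
  ring

/-- Both sides reduce to A_n(f) and the sum twisted by q^a; the contiguous relation brings the
twisted sum from degree n + 1 down to n. -/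
theorem altConv_recurrence
    (hf : ∀ a, f (a + 1) * (1 - q ^ (a + 1)) = f a * (1 - c * q ^ (a + 1)))
    {n : ℕ} (hn : Even n) :
    q * (altConv q f (n + 2) - altConv q (fun a => f a - c * shiftRight f a) (n + 2)) =
      altConv q f n - altConv q (fun a => f a * (1 - c * q ^ (a + 1))) n := by
  rw [altConv_sub_shiftRight hn, altConv_mul_one_sub hn, sum_antidiagonal_twist_succ hf hn]
  ring

end Antidiagonal

/-! ### Gaussian binomials: recursion in a, raising and lowering i -/

section GaussBinom

variable {K : Type*} [Field K] {q : K}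

theorem qShifted_succ (x q : K) (n : ℕ) :
    qShifted x q (n + 1) = qShifted x q n * (1 - x * q ^ n) :=
  Finset.prod_range_succ _ _

theorem one_sub_mul_pow_ne_zero (hq : ∀ n : ℕ, 1 ≤ n → q ^ n ≠ 1) (n : ℕ) :
    1 - q * q ^ n ≠ 0 := by
  rw [← pow_succ', sub_ne_zero]
  exact (hq (n + 1) (by omega)).symm

theorem qShifted_self_ne_zero (hq : ∀ n : ℕ, 1 ≤ n → q ^ n ≠ 1) (n : ℕ) :
    qShifted q q n ≠ 0 :=
  Finset.prod_ne_zero_iff.2 fun j _ => one_sub_mul_pow_ne_zero hq j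

theorem gaussBinom_add (q : K) (i a : ℕ) :
    gaussBinom q (i + a) i = qShifted q q (i + a) / (qShifted q q i * qShifted q q a) := by
  simp [gaussBinom]

theorem gaussBinom_add_zero (hq : ∀ n : ℕ, 1 ≤ n → q ^ n ≠ 1) (i : ℕ) :
    gaussBinom q (i + 0) i = 1 := by
  have := qShifted_self_ne_zero hq i
  rw [gaussBinom_add]
  simp [qShifted] at this ⊢
  exact this

theorem gaussBinom_zero_right (hq : ∀ n : ℕ, 1 ≤ n → q ^ n ≠ 1) (a : ℕ) :
    gaussBinom q (0 + a) 0 = 1 := by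
  have := qShifted_self_ne_zero hq a
  rw [gaussBinom_add]
  simpa [qShifted] using this

theorem gaussBinom_add_succ_mul (hq : ∀ n : ℕ, 1 ≤ n → q ^ n ≠ 1) (i a : ℕ) :
    gaussBinom q (i + (a + 1)) i * (1 - q ^ (a + 1)) =
      gaussBinom q (i + a) i * (1 - q ^ i * q ^ (a + 1)) := by
  have h1 := qShifted_self_ne_zero hq i
  have h2 := qShifted_self_ne_zero hq a
  have h3 := one_sub_mul_pow_ne_zero hq a
  rw [gaussBinom_add, gaussBinom_add, ← add_assoc, qShifted_succ, qShifted_succ]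
  field_simp
  ring

theorem one_sub_mul_gaussBinom_succ (hq : ∀ n : ℕ, 1 ≤ n → q ^ n ≠ 1) (i a : ℕ) :
    (1 - q ^ (i + 1)) * gaussBinom q (i + 1 + a) (i + 1) =
      gaussBinom q (i + a) i * (1 - q ^ i * q ^ (a + 1)) := by
  have h1 := qShifted_self_ne_zero hq i
  have h2 := qShifted_self_ne_zero hq a
  have h3 := one_sub_mul_pow_ne_zero hq i
  rw [gaussBinom_add, gaussBinom_add, add_right_comm, qShifted_succ, qShifted_succ]
  field_simp
  ring

theorem gaussBinom_pascal (hq : ∀ n : ℕ, 1 ≤ n → q ^ n ≠ 1) (i a : ℕ) :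
    gaussBinom q (i + 1 + (a + 1)) (i + 1) - q ^ (i + 1) * gaussBinom q (i + 1 + a) (i + 1) =
      gaussBinom q (i + (a + 1)) i := by
  have h1 := qShifted_self_ne_zero hq i
  have h2 := qShifted_self_ne_zero hq a
  have h3 := one_sub_mul_pow_ne_zero hq i
  have h4 := one_sub_mul_pow_ne_zero hq a
  have e1 : i + 1 + (a + 1) = i + a + 1 + 1 := by ring
  have e2 : i + 1 + a = i + a + 1 := by ring
  rw [gaussBinom_add, gaussBinom_add, gaussBinom_add, e1, e2, ← add_assoc i a 1,
    qShifted_succ q q (i + a + 1), qShifted_succ q q (i + a), qShifted_succ q q i,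
    qShifted_succ q q a]
  field_simp
  ring

end GaussBinom

/-! ### The coefficients as convolutions, and their recurrence -/

section Coefficients

open Finset

variable {K : Type*} [Field K] {q : K}

theorem sCoeffNat_eq_altConv (hq0 : q ≠ 0) (i N : ℕ) :
    sCoeffNat q i N =
      (-1) ^ N * q ^ N * altConv q (fun a => gaussBinom q (i + a) i) (2 * N) := by
  rw [sCoeffNat, altConv, Finset.mul_sum, Finset.mul_sum]
  refine Finset.sum_nbij' (fun n : ℤ => (((N : ℤ) - n).toNat, ((N : ℤ) + n).toNat))
    (fun p => (p.2 : ℤ) - N) ?_ ?_ ?_ ?_ ?_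
  · intro n hn
    rw [Finset.mem_Icc] at hn
    rw [HasAntidiagonal.mem_antidiagonal]
    dsimp only
    omega
  · rintro ⟨a, b⟩ hp
    rw [HasAntidiagonal.mem_antidiagonal] at hp
    rw [Finset.mem_Icc]
    dsimp only at hp ⊢
    omega
  · intro n hn
    rw [Finset.mem_Icc] at hn
    dsimp only
    omega
  · rintro ⟨a, b⟩ hp
    rw [HasAntidiagonal.mem_antidiagonal] at hp
    dsimp only at hp ⊢
    ext <;> dsimp only <;> omega
  · intro n hn
    rw [Finset.mem_Icc] at hn
    obtain ⟨a, ha⟩ : ∃ a : ℕ, (a : ℤ) = N - n := ⟨((N : ℤ) - n).toNat, by omega⟩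
    obtain ⟨b, hb⟩ : ∃ b : ℕ, (b : ℤ) = N + n := ⟨((N : ℤ) + n).toNat, by omega⟩
    have hn' : n = N - a := by omega
    rw [← ha, ← hb]
    simp only [Int.toNat_natCast]
    have hsign : (-1 : K) ^ n = (-1) ^ N * (-1) ^ a := by
      rw [hn', zpow_sub₀ (by norm_num), zpow_natCast, zpow_natCast, div_eq_mul_inv, ← inv_pow]
      norm_num
    have hpow : q ^ (N * (N + 1)) * q ^ (-(n ^ 2)) = q ^ N * q ^ (a * b) := by
      rw [← pow_add, ← zpow_natCast, ← zpow_natCast, ← zpow_add₀ hq0]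
      congr 1
      push_cast
      rw [ha, hb]
      ring
    rw [hsign]
    linear_combination (gaussBinom q (i + a) i * gaussBinom q (i + b) i * (-1) ^ N * (-1) ^ a) *
      hpow

theorem sCoeff_natCast (q : K) (i N : ℕ) : sCoeff q (i : ℤ) N = sCoeffNat q i N := rfl

theorem sCoeff_sub_one_eq_altConv (hq0 : q ≠ 0) (hq : ∀ n : ℕ, 1 ≤ n → q ^ n ≠ 1) (i N : ℕ) :
    sCoeff q ((i : ℤ) - 1) N = (-1) ^ N * q ^ N *
      altConv q (fun a => gaussBinom q (i + a) i -
        q ^ i * shiftRight (fun a => gaussBinom q (i + a) i) a) (2 * N) := by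
  rcases i with _ | i
  · have hfun : (fun a => gaussBinom q (0 + a) 0 -
        q ^ 0 * shiftRight (fun a => gaussBinom q (0 + a) 0) a) =
        fun a => if a = 0 then (1 : K) else 0 := by
      funext a
      rcases a with _ | a
      · simp [shiftRight, gaussBinom_zero_right hq 0]
      · simp only [shiftRight]
        rw [gaussBinom_zero_right hq, gaussBinom_zero_right hq]
        simp
    rw [hfun]
    have h : sCoeff q (((0 : ℕ) : ℤ) - 1) N = if N = 0 then 1 else 0 := rfl
    rw [h, altConv]
    rcases N with _ | N
    · simp
    · rw [if_neg (Nat.succ_ne_zero N), Finset.sum_eq_zero, mul_zero]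
      rintro ⟨a, b⟩ hp
      rw [HasAntidiagonal.mem_antidiagonal] at hp
      dsimp only at hp ⊢
      rcases a with _ | a
      · rw [if_neg (show b ≠ 0 by omega), mul_zero]
      · simp
  · have hfun : (fun a => gaussBinom q (i + 1 + a) (i + 1) -
        q ^ (i + 1) * shiftRight (fun a => gaussBinom q (i + 1 + a) (i + 1)) a) =
        fun a => gaussBinom q (i + a) i := by
      funext a
      rcases a with _ | a
      · rw [gaussBinom_add_zero hq, gaussBinom_add_zero hq]
        simp [shiftRight]
      · exact gaussBinom_pascal hq i a
    have hi : ((i + 1 : ℕ) : ℤ) - 1 = (i : ℤ) := by push_cast; ring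
    rw [hfun, hi, sCoeff_natCast, sCoeffNat_eq_altConv hq0]

theorem sCoeffNat_zero (hq : ∀ n : ℕ, 1 ≤ n → q ^ n ≠ 1) (i : ℕ) : sCoeffNat q i 0 = 1 := by
  have := gaussBinom_add_zero hq i
  simp [sCoeffNat] at this ⊢
  simp [this]

theorem sCoeff_sub_one_zero (hq : ∀ n : ℕ, 1 ≤ n → q ^ n ≠ 1) (i : ℕ) :
    sCoeff q ((i : ℤ) - 1) 0 = 1 := by
  rcases i with _ | i
  · rfl
  · have hi : ((i + 1 : ℕ) : ℤ) - 1 = (i : ℤ) := by push_cast; ring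
    rw [hi, sCoeff_natCast, sCoeffNat_zero hq]

theorem sCoeff_recurrence (hq0 : q ≠ 0) (hq : ∀ n : ℕ, 1 ≤ n → q ^ n ≠ 1) (i N : ℕ) :
    sCoeff q (i : ℤ) (N + 1) + sCoeff q (i : ℤ) N
      - (1 - q ^ (i + 1)) ^ 2 * sCoeff q ((i : ℤ) + 1) N - sCoeff q ((i : ℤ) - 1) (N + 1) = 0 := by
  have hi : (i : ℤ) + 1 = ((i + 1 : ℕ) : ℤ) := by push_cast; ring
  have hrec := altConv_recurrence (f := fun a => gaussBinom q (i + a) i)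
    (gaussBinom_add_succ_mul hq i) (even_two_mul N)
  have hmul : altConv q (fun a => gaussBinom q (i + a) i * (1 - q ^ i * q ^ (a + 1))) (2 * N) =
      (1 - q ^ (i + 1)) ^ 2 *
        altConv q (fun a => gaussBinom q (i + 1 + a) (i + 1)) (2 * N) := by
    simp only [← one_sub_mul_gaussBinom_succ hq, altConv, Finset.mul_sum]
    exact Finset.sum_congr rfl fun p _ => by ring
  rw [hmul] at hrec
  rw [hi, sCoeff_natCast, sCoeff_natCast, sCoeff_natCast, sCoeff_sub_one_eq_altConv hq0 hq,
    sCoeffNat_eq_altConv hq0, sCoeffNat_eq_altConv hq0, sCoeffNat_eq_altConv hq0,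
    show 2 * (N + 1) = 2 * N + 2 by ring]
  -- From N to N + 1 the prefactor gains -q, which accounts for the q in `hrec`.
  linear_combination (-(-1) ^ N * q ^ N) * hrec

theorem sSeries_recurrence (hq0 : q ≠ 0) (hq : ∀ n : ℕ, 1 ≤ n → q ^ n ≠ 1) (i : ℕ) :
    sSeries q (i : ℤ) * (1 + X) - C ((1 - q ^ (i + 1)) ^ 2) * X * sSeries q ((i : ℤ) + 1) =
      sSeries q ((i : ℤ) - 1) := by
  ext N
  rcases N with _ | N
  · simp [sSeries, mul_assoc, sCoeff_sub_one_zero hq, sCoeff_natCast, sCoeffNat_zero hq]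
  · have h := sCoeff_recurrence hq0 hq i N
    simp only [mul_add, mul_one, mul_assoc, map_sub, map_add, coeff_C_mul, coeff_succ_X_mul,
      coeff_succ_mul_X, sSeries, coeff_mk]
    linear_combination h

end Coefficients

/-! ### Convergence of the continued fraction -/

section ContinuedFraction

variable {K : Type*} [Field K]

theorem cfTrunc_congr_of_tails (a : ℕ → K) (F : ℕ → K⟦X⟧)
    (hF : ∀ j, F j * (1 + X - C (a j) * X * F (j + 1)) = 1) (m : ℕ) :
    ∀ j, (X : K⟦X⟧) ^ m ∣ cfTrunc (fun k => a (j + k)) m - F j := by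
  induction m with
  | zero => simp
  | succ m ih =>
    intro j
    have htail : (fun k => a (j + (k + 1))) = fun k => a (j + 1 + k) := by
      funext k
      rw [add_assoc, add_comm 1 k]
    obtain ⟨D, hD⟩ := ih (j + 1)
    set G := cfTrunc (fun k => a (j + 1 + k)) m with hG
    have hA : (1 + X - C (a j) * X * G) * (1 + X - C (a j) * X * G)⁻¹ = 1 :=
      PowerSeries.mul_inv_cancel _ (by simp)
    have hcf : cfTrunc (fun k => a (j + k)) (m + 1) = (1 + X - C (a j) * X * G)⁻¹ := by
      simp only [cfTrunc, htail, add_zero, hG]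
    rw [hcf]
    set A := (1 + X - C (a j) * X * G)⁻¹
    -- A - F_j = A F_j (F_j⁻¹ - A⁻¹) = A F_j a_j X (G - F_{j+1}), and G - F_{j+1} = X^m D.
    refine ⟨A * F j * C (a j) * D, ?_⟩
    linear_combination (A * F j * C (a j) * X) * hD - A * hF j + F j * hA

theorem cfConvergesTo_of_tails (a : ℕ → K) (F : ℕ → K⟦X⟧)
    (hF : ∀ j, F j * (1 + X - C (a j) * X * F (j + 1)) = 1) :
    CFConvergesTo a (F 0) := by
  intro N
  filter_upwards [eventually_gt_atTop N] with m hm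
  have h := cfTrunc_congr_of_tails a F hF m 0
  simp only [zero_add] at h
  rw [X_pow_dvd_iff] at h
  exact sub_eq_zero.1 (by simpa using h N hm)

end ContinuedFraction

theorem constantCoeff_sSeries_sub_one {K : Type*} [Field K] {q : K}
    (hq : ∀ n : ℕ, 1 ≤ n → q ^ n ≠ 1) (i : ℕ) :
    constantCoeff (sSeries q ((i : ℤ) - 1)) = 1 := by
  rw [← coeff_zero_eq_constantCoeff_apply, sSeries, coeff_mk, sCoeff_sub_one_zero hq]

theorem mainTheorem7 {K : Type*} [Field K] (q : K) (hq0 : q ≠ 0)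
    (hq : ∀ n : ℕ, 1 ≤ n → q ^ n ≠ 1) :
    -- the tails of the continued fraction; the series in the denominator is invertible
    (∀ i : ℕ,
      constantCoeff (sSeries q ((i : ℤ) - 1)) ≠ 0 ∧
      CFConvergesTo (fun j => (1 - q ^ (i + 1 + j)) ^ 2)
        (sSeries q (i : ℤ) * (sSeries q ((i : ℤ) - 1))⁻¹)) ∧
    -- the recurrence of the coefficients, for `N ≥ 1`
    (∀ i N : ℕ, 1 ≤ N →
      sCoeff q (i : ℤ) N + sCoeff q (i : ℤ) (N - 1)
        - (1 - q ^ (i + 1)) ^ 2 * sCoeff q ((i : ℤ) + 1) (N - 1)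
        - sCoeff q ((i : ℤ) - 1) N = 0) ∧
    -- the recurrence for `N = 0`, where the terms of index `N - 1 = -1` are zero
    (∀ i : ℕ, sCoeff q (i : ℤ) 0 - sCoeff q ((i : ℤ) - 1) 0 = 0) := by
  have hne : ∀ i : ℕ, constantCoeff (sSeries q ((i : ℤ) - 1)) ≠ 0 := fun i => by
    rw [constantCoeff_sSeries_sub_one hq]
    exact one_ne_zero
  refine ⟨fun i => ⟨hne i, ?_⟩, ?_, ?_⟩
  · refine cfConvergesTo_of_tails _
      (fun j => sSeries q ((i + j : ℕ) : ℤ) * (sSeries q (((i + j : ℕ) : ℤ) - 1))⁻¹) fun j => ?_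
    have hidx : ((i + (j + 1) : ℕ) : ℤ) = ((i + j : ℕ) : ℤ) + 1 := by push_cast; ring
    have hsub : ((i + j : ℕ) : ℤ) + 1 - 1 = ((i + j : ℕ) : ℤ) := by ring
    have h0 := PowerSeries.mul_inv_cancel _ (hne (i + j))
    have h1 := PowerSeries.mul_inv_cancel _ (hne (i + j + 1))
    have hrec := sSeries_recurrence hq0 hq (i + j)
    rw [Nat.cast_add_one, hsub] at h1
    rw [show i + 1 + j = i + j + 1 by ring, hidx, hsub]
    -- Divide the recurrence by s_{i+j-1}; `h1` cancels s_{i+j} against the denominator of the next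
    -- tail.
    linear_combination (sSeries q (((i + j : ℕ) : ℤ) - 1))⁻¹ * hrec + h0 -
      (C ((1 - q ^ (i + j + 1)) ^ 2) * X * sSeries q (((i + j : ℕ) : ℤ) + 1) *
        (sSeries q (((i + j : ℕ) : ℤ) - 1))⁻¹) * h1
  · intro i N hN
    obtain ⟨N, rfl⟩ := Nat.exists_eq_add_of_le' hN
    exact sCoeff_recurrence hq0 hq i N
  · intro i
    rw [sCoeff_sub_one_zero hq, sCoeff_natCast, sCoeffNat_zero hq, sub_self]
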